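/- Let $A$ be a countable alphabet and let $a,b,c,d\in A$ be pairwise distinct letters. A synchronization tree over $A$ is a rooted tree with countably many vertices whose edges are labelled in $A\cup\{\mathrm{ex}\}$, $\mathrm{ex}\notin A$, such that the target of every $\mathrm{ex}$-labelled edge is a leaf; morphisms preserve the root and the labelled edges. These trees form a category with colimits of all $\omega$-diagrams. Its initial object is the tree $0$ without edges. The signature $\Gamma$ consists of the constants $0$ and $1$, a binary symbol $+$, and a unary symbol for each letter of $A$. They are interpreted as functors: $1$ is the tree with a single edge, labelled $\mathrm{ex}$; $t+t'$ is the disjoint union of $t$ and $t'$ with the roots identified; and $x(t)$, for $x\in A$, is the tree obtained from $t$ by adding a new root with an edge labelled $x$ to the old root. A $\Gamma$-recursion scheme is a finite system of equations $F_i(v_1,\dots,v_{k_i})=t_i$ ($1\le i\le n$, $n\ge 1$), where $t_i$ is a term over $\Gamma\cup\{F_1,\dots,F_n\}$ in the variables $v_1,\dots,v_{k_i}$. Its initial solution is the colimit of the $\omega$-diagram of tuples of functors obtained by iterating the right-hand sides from the constant functors with value $0$. A synchronization tree is $\Gamma$-algebraic if it is isomorphic to the first component of the initial solution of a $\Gamma$-recursion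 scheme with $k_1=0$. The path language of a synchronization tree is the set of the words in $A^*$ that label a path from the root to the source of an $\mathrm{ex}$-labelled edge, and two trees are language equivalent if they have the same path language. Let $t_{\mathrm{bag}}$ be the synchronization tree obtained by unfolding from $(0,0)$ the labelled transition system with states $(i,j)\in\mathbb N^2$ and transitions $$(i,j)\xrightarrow{a}(i+1,j),\quad (i+1,j)\xrightarrow{b}(i,j),\quad (i,j)\xrightarrow{c}(i,j+1),\quad (i,j+1)\xrightarrow{d}(i,j)$$ for all $i,j\ge 0$, together with an edge labelled $\mathrm{ex}$ from the state $(0,0)$, which is the only final state, to an additional state without outgoing edges. **Proposition.** The tree $t_{\mathrm{bag}}$ is not $\Gamma$-algebraic, not even up to language equivalence: no $\Gamma$-algebraic synchronization tree over $A$ is language equivalent to $t_{\mathrm{bag}}$. -/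

import Mathlib

open CategoryTheory

/-! ## Continuous categorical algebras -/

/-- A ranked set of operation symbols. -/
structure RankedSignature where
  Op : Type
  rank : Op → ℕ

/-- A continuous categorical algebra structure on `C`: a distinguished initial object, colimits of
all `ω`-diagrams, and for each symbol of rank `r` a functor `Cʳ ⥤ C` that preserves these. -/
structure ContinuousAlgebra (S : RankedSignature) (C : Type*) [Category C] where
  bot : C
  botIsInitial : Limits.IsInitial bot
  hasColimits : Limits.HasColimitsOfShape ℕ C
  op : (σ : S.Op) → (Fin (S.rank σ) → C) ⥤ C
  continuous : ∀ σ, Limits.PreservesColimitsOfShape ℕ (op σ)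

/-! ## Recursion schemes and their initial solutions -/

/-- Terms over the signature `S` extended by functor variables `F₀, …, Fₙ₋₁`, where `Fⱼ` has rank
`k j`, in the variables `v₀, …, vₘ₋₁`. -/
inductive SchemeTerm (S : RankedSignature) {n : ℕ} (k : Fin n → ℕ) (m : ℕ) : Type
  | var (i : Fin m) : SchemeTerm S k m
  | op (σ : S.Op) (ts : Fin (S.rank σ) → SchemeTerm S k m) : SchemeTerm S k m
  | call (j : Fin n) (ts : Fin (k j) → SchemeTerm S k m) : SchemeTerm S k m

/-- A recursion scheme: a finite nonempty system of equations `Fⱼ(v₀, …) = rhs j`, where `Fⱼ` has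
`k j` arguments. The first equation is the one with index `0`. -/
structure RecursionScheme (S : RankedSignature) where
  n : ℕ
  k : Fin (n + 1) → ℕ
  rhs : (j : Fin (n + 1)) → SchemeTerm S k (k j)

/-- Target tupling of functors and of natural transformations. -/
def tupling (ι : Type) (D : Type*) [Category D] (C : Type*) [Category C] :
    (ι → (D ⥤ C)) ⥤ (D ⥤ (ι → C)) where
  obj f := Functor.pi' f
  map α := { app := fun x i => (α i).app x
             naturality := fun x y g => by funext i; exact (α i).naturality g }

/-- Assignments of a functor `C^(k j) ⥤ C` to each functor variable `Fⱼ`. -/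
abbrev Interpretation {n : ℕ} (k : Fin n → ℕ) (C : Type*) [Category C] :=
  (j : Fin n) → ((Fin (k j) → C) ⥤ C)

/-- Composition of two families of functors depending functorially on an object of `I`. On
morphisms it is horizontal composition of natural transformations. -/
def composition {I D D' C : Type*} [Category I] [Category D] [Category D'] [Category C]
    (H : I ⥤ (D ⥤ D')) (G : I ⥤ (D' ⥤ C)) : I ⥤ (D ⥤ C) where
  obj f := H.obj f ⋙ G.obj f
  map α := NatTrans.hcomp (H.map α) (G.map α)
  map_id f := by ext x; simp
  map_comp α β := by rw [H.map_comp, G.map_comp, NatTrans.exchange]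

/-- The functor induced by a term: it sends an interpretation of the functor variables to the
functor `Cᵐ ⥤ C` that the term denotes, and a family of natural transformations to the induced
natural transformation. -/
def SchemeTerm.eval {S : RankedSignature} {C : Type*} [Category C] (𝒜 : ContinuousAlgebra S C)
    {n : ℕ} {k : Fin n → ℕ} {m : ℕ} :
    SchemeTerm S k m → (Interpretation k C ⥤ ((Fin m → C) ⥤ C))
  | .var i => (Functor.const _).obj (Pi.eval (fun _ : Fin m => C) i)
  | .op σ ts =>
      composition (Functor.pi' (fun i => (ts i).eval 𝒜) ⋙ tupling _ _ _)
        ((Functor.const _).obj (𝒜.op σ))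
  | .call j ts =>
      composition (Functor.pi' (fun i => (ts i).eval 𝒜) ⋙ tupling _ _ _) (Pi.eval _ j)

namespace RecursionScheme

variable {S : RankedSignature} {C : Type*} [Category C]
  (E : RecursionScheme S) (𝒜 : ContinuousAlgebra S C)

/-- The endofunctor on interpretations given by the right-hand sides of the equations. -/
def endo : Interpretation E.k C ⥤ Interpretation E.k C :=
  Functor.pi' (fun j => (E.rhs j).eval 𝒜)

/-- The approximations `g₀, g₁, …` of the initial solution: `g₀` consists of the constant functors
with value the initial object, and `gᵢ₊₁ = E(gᵢ)`. -/
def approx : ℕ → Interpretation E.k C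
  | 0 => fun _ => (Functor.const _).obj 𝒜.bot
  | i + 1 => (E.endo 𝒜).obj (approx i)

/-- The transition morphisms `φᵢ : gᵢ ⟶ gᵢ₊₁`: `φ₀` is the unique one, and `φᵢ₊₁ = E(φᵢ)`. -/
def approxMap : (i : ℕ) → (E.approx 𝒜 i ⟶ E.approx 𝒜 (i + 1))
  | 0 => fun j =>
      { app := fun x => 𝒜.botIsInitial.to ((E.approx 𝒜 1 j).obj x)
        naturality := fun _ _ _ => 𝒜.botIsInitial.hom_ext _ _ }
  | i + 1 => (E.endo 𝒜).map (approxMap i)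

/-- The `ω`-diagram `g₀ ⟶ g₁ ⟶ ⋯` of interpretations. -/
def approxDiagram : ℕ ⥤ Interpretation E.k C :=
  Functor.ofSequence (E.approxMap 𝒜)

/-- The components of the initial solution: the colimit of the diagram of approximations
(colimits in a product category being formed componentwise). -/
noncomputable def solution (j : Fin (E.n + 1)) : (Fin (E.k j) → C) ⥤ C :=
  haveI := 𝒜.hasColimits
  Limits.colimit (E.approxDiagram 𝒜 ⋙ Pi.eval _ j)

end RecursionScheme

/-- An object is algebraic if it is isomorphic to the first component of the initial solution of a
recursion scheme whose first functor variable has rank `0` (so that this component is a functor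
`C⁰ ⥤ C`, identified with its value at the empty tuple). -/
def IsAlgebraicObject {S : RankedSignature} {C : Type*} [Category C] (𝒜 : ContinuousAlgebra S C)
    (c : C) : Prop :=
  ∃ (E : RecursionScheme S) (h : E.k 0 = 0),
    Nonempty (c ≅ (E.solution 𝒜 0).obj (fun i => (Fin.cast h i).elim0))

/-! ## Synchronization trees -/

/-- `IsPath R u p v`: there is a path from `u` to `v` in the labelled graph with edge relation `R`,
and `p` is the list of the labels and targets of its edges. -/
inductive IsPath {V L : Type} (R : V → L → V → Prop) : V → List (L × V) → V → Prop
  | nil (u : V) : IsPath R u [] u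
  | cons {u v w : V} {x : L} {p : List (L × V)} :
      R u x v → IsPath R v p w → IsPath R u ((x, v) :: p) w

/-- A synchronization tree over `A`. The edges are labelled in `Option A`, with `none` for the
label `ex` of successful termination. As paths are considered with their labels, uniqueness of
paths also says that an edge has only one label. -/
structure SyncTree (A : Type) where
  V : Type
  countable : Countable V
  root : V
  Edge : V → Option A → V → Prop
  existsUnique_path : ∀ u, ∃! p, IsPath Edge root p u
  exit_leaf : ∀ {u v}, Edge u none v → ∀ x w, ¬ Edge v x w

namespace SyncTree

variable {A : Type}

/-- Morphisms preserve the root and the labelled edges. -/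
@[ext]
structure Hom (t t' : SyncTree A) where
  toFun : t.V → t'.V
  map_root : toFun t.root = t'.root
  map_edge : ∀ {u x v}, t.Edge u x v → t'.Edge (toFun u) x (toFun v)

instance : Category (SyncTree A) where
  Hom := Hom
  id t := ⟨id, rfl, fun h => h⟩
  comp f g := ⟨g.toFun ∘ f.toFun, by simp [f.map_root, g.map_root],
    fun h => g.map_edge (f.map_edge h)⟩

@[ext]
theorem hom_ext {t t' : SyncTree A} {f g : t ⟶ t'} (h : ∀ u, f.toFun u = g.toFun u) : f = g :=
  Hom.ext (funext h)

@[simp] theorem id_toFun (t : SyncTree A) (u : t.V) : Hom.toFun (𝟙 t) u = u := rfl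

@[simp] theorem comp_toFun {t t' t'' : SyncTree A} (f : t ⟶ t') (g : t' ⟶ t'') (u : t.V) :
    Hom.toFun (f ≫ g) u = g.toFun (f.toFun u) := rfl

end SyncTree

theorem IsPath.append_singleton {V L : Type} {R : V → L → V → Prop} {u v w : V} {x : L}
    {p : List (L × V)} (h : IsPath R u p v) (e : R v x w) : IsPath R u (p ++ [(x, w)]) w := by
  induction h with
  | nil u => exact .cons e (.nil _)
  | cons e' _ ih => exact .cons e' (ih e)

theorem IsPath.of_append_singleton {V L : Type} {R : V → L → V → Prop} {y : L × V} :
    ∀ {p : List (L × V)} {u w : V}, IsPath R u (p ++ [y]) w →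
      y.2 = w ∧ ∃ v, IsPath R u p v ∧ R v y.1 w
  | [], u, w, h => by
      cases h with
      | cons e h' => cases h'; exact ⟨rfl, u, .nil u, e⟩
  | z :: p, u, w, h => by
      cases h with
      | cons e h' =>
        obtain ⟨h1, v, h2, h3⟩ := IsPath.of_append_singleton h'
        exact ⟨h1, v, .cons e h2, h3⟩

theorem IsPath.map {V V' L : Type} {R : V → L → V → Prop} {R' : V' → L → V' → Prop} (f : V → V')
    (hf : ∀ {u x v}, R u x v → R' (f u) x (f v)) {u v : V} {p : List (L × V)}
    (h : IsPath R u p v) : IsPath R' (f u) (p.map fun y => (y.1, f y.2)) (f v) := by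
  induction h with
  | nil u => exact .nil _
  | cons e _ ih => exact .cons (hf e) ih

/-- A graph in which every vertex is reachable from `r`, in which `r` has no incoming edge, and
in which every vertex has at most one incoming edge, is a tree. -/
theorem existsUnique_path_of {V L : Type} {R : V → L → V → Prop} {r : V}
    (reach : ∀ u, ∃ p, IsPath R r p u) (hr : ∀ u x, ¬ R u x r)
    (huniq : ∀ {u u' v x x'}, R u x v → R u' x' v → u = u' ∧ x = x') :
    ∀ u, ∃! p, IsPath R r p u := by
  intro u
  obtain ⟨p, hp⟩ := reach u
  refine ⟨p, hp, ?_⟩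
  intro q hq
  induction p using List.reverseRecOn generalizing u q with
  | nil =>
    cases hp
    induction q using List.reverseRecOn with
    | nil => rfl
    | append_singleton q y _ =>
      obtain ⟨_, v, _, e⟩ := hq.of_append_singleton
      exact absurd e (hr _ _)
  | append_singleton p y ih =>
    obtain ⟨rfl, v, h1, e⟩ := hp.of_append_singleton
    induction q using List.reverseRecOn with
    | nil => cases hq; exact absurd e (hr _ _)
    | append_singleton q z _ =>
      obtain ⟨hz, v', h1', e'⟩ := hq.of_append_singleton
      obtain ⟨rfl, hx⟩ := huniq e e'
      rw [ih v h1 q h1', Prod.ext hx hz.symm]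

namespace SyncTree

variable {A : Type}

theorem reach (t : SyncTree A) (u : t.V) : ∃ p, IsPath t.Edge t.root p u :=
  (t.existsUnique_path u).exists

theorem not_edge_root (t : SyncTree A) (u : t.V) (x : Option A) : ¬ t.Edge u x t.root := by
  intro e
  obtain ⟨p, hp⟩ := t.reach u
  have := (t.existsUnique_path t.root).unique (hp.append_singleton e) (.nil _)
  simp at this

theorem edge_unique (t : SyncTree A) {u u' v : t.V} {x x' : Option A} (e : t.Edge u x v)
    (e' : t.Edge u' x' v) : u = u' ∧ x = x' := by
  obtain ⟨p, hp⟩ := t.reach u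
  obtain ⟨p', hp'⟩ := t.reach u'
  have h := (t.existsUnique_path v).unique (hp.append_singleton e) (hp'.append_singleton e')
  have h2 := List.append_inj' h rfl
  obtain ⟨rfl, h3⟩ := h2
  refine ⟨?_, by simpa using h3⟩
  clear h h3 e e'
  induction p using List.reverseRecOn with
  | nil => cases hp; cases hp'; rfl
  | append_singleton p y _ =>
    exact hp.of_append_singleton.1.symm.trans hp'.of_append_singleton.1

theorem exists_edge (t : SyncTree A) {v : t.V} (hv : v ≠ t.root) : ∃ u x, t.Edge u x v := by
  obtain ⟨p, hp⟩ := t.reach v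
  induction p using List.reverseRecOn with
  | nil => cases hp; exact absurd rfl hv
  | append_singleton p y _ =>
    obtain ⟨_, u, _, e⟩ := hp.of_append_singleton
    exact ⟨u, _, e⟩

/-! ### The operations -/

/-- The tree without edges. -/
def zero (A : Type) : SyncTree A where
  V := Unit
  countable := inferInstance
  root := ()
  Edge _ _ _ := False
  existsUnique_path := existsUnique_path_of (fun _ => ⟨[], .nil _⟩) (by simp) (by simp)
  exit_leaf := by simp

/-- The tree with a single edge, labelled `ex`. -/
def one (A : Type) : SyncTree A where
  V := Bool
  countable := inferInstance
  root := false
  Edge u x v := u = false ∧ x = none ∧ v = true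
  existsUnique_path := existsUnique_path_of
    (by rintro (_ | _)
        · exact ⟨[], .nil _⟩
        · exact ⟨[(none, true)], .cons ⟨rfl, rfl, rfl⟩ (.nil _)⟩)
    (by simp) (by simp +contextual)
  exit_leaf := by simp +contextual

/-- The tree `a.t`: a new root with a single edge, labelled `a`, to the root of `t`. -/
def pre (a : A) (t : SyncTree A) : SyncTree A where
  V := Option t.V
  countable := haveI := t.countable; inferInstance
  root := none
  Edge u x v := (u = none ∧ x = some a ∧ v = some t.root) ∨
    ∃ u' v', u = some u' ∧ v = some v' ∧ t.Edge u' x v'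
  existsUnique_path := existsUnique_path_of
    (by
      rintro (_ | u)
      · exact ⟨[], .nil _⟩
      · obtain ⟨p, hp⟩ := t.reach u
        exact ⟨_, .cons (Or.inl ⟨rfl, rfl, rfl⟩)
          (hp.map some (fun e => Or.inr ⟨_, _, rfl, rfl, e⟩))⟩)
    (by simp)
    (by
      rintro u u' v x x' (⟨rfl, rfl, rfl⟩ | ⟨u, v, rfl, rfl, e⟩)
        (⟨rfl, rfl, h⟩ | ⟨u', v', rfl, h, e'⟩)
      · simp
      · cases h; exact absurd e' (t.not_edge_root _ _)
      · cases h; exact absurd e (t.not_edge_root _ _)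
      · cases h; simpa using t.edge_unique e e')
  exit_leaf := by
    rintro u v (⟨rfl, h, rfl⟩ | ⟨u, v, rfl, rfl, e⟩) x w
    · simp at h
    · rintro (⟨h, _⟩ | ⟨u', v', h, rfl, e'⟩)
      · simp at h
      · cases h; exact t.exit_leaf e _ _ e'

/-- The sum of two trees: the disjoint union with the two roots identified. Here a vertex `u` of
`t` is represented by `(u, root of t')`, and a vertex `v` of `t'` by `(root of t, v)`. -/
def sum (t t' : SyncTree A) : SyncTree A where
  V := {p : t.V × t'.V // p.1 = t.root ∨ p.2 = t'.root}
  countable := haveI := t.countable; haveI := t'.countable; inferInstance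
  root := ⟨(t.root, t'.root), Or.inl rfl⟩
  Edge p x q := (∃ u v, p = ⟨(u, t'.root), Or.inr rfl⟩ ∧ q = ⟨(v, t'.root), Or.inr rfl⟩ ∧
      t.Edge u x v) ∨
    (∃ u v, p = ⟨(t.root, u), Or.inl rfl⟩ ∧ q = ⟨(t.root, v), Or.inl rfl⟩ ∧ t'.Edge u x v)
  existsUnique_path := existsUnique_path_of
    (by
      rintro ⟨⟨u, v⟩, (h | h)⟩
      · dsimp only at h; subst h
        obtain ⟨p, hp⟩ := t'.reach v
        exact ⟨_, hp.map (fun v => (⟨(t.root, v), Or.inl rfl⟩ :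
          {p : t.V × t'.V // p.1 = t.root ∨ p.2 = t'.root})) (fun e => Or.inr ⟨_, _, rfl, rfl, e⟩)⟩
      · dsimp only at h; subst h
        obtain ⟨p, hp⟩ := t.reach u
        exact ⟨_, hp.map (fun v => (⟨(v, t'.root), Or.inr rfl⟩ :
          {p : t.V × t'.V // p.1 = t.root ∨ p.2 = t'.root})) (fun e => Or.inl ⟨_, _, rfl, rfl, e⟩)⟩)
    (by
      rintro p x (⟨u, v, -, h, e⟩ | ⟨u, v, -, h, e⟩)
      · simp at h; subst h; exact t.not_edge_root _ _ e
      · simp at h; subst h; exact t'.not_edge_root _ _ e)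
    (by
      rintro p p' q x x' (⟨u, v, rfl, rfl, e⟩ | ⟨u, v, rfl, rfl, e⟩)
        (⟨u', v', rfl, h, e'⟩ | ⟨u', v', rfl, h, e'⟩)
      · simp at h; subst h; simpa using t.edge_unique e e'
      · simp at h; rw [h.1] at e; exact absurd e (t.not_edge_root _ _)
      · simp at h; rw [h.2] at e; exact absurd e (t'.not_edge_root _ _)
      · simp at h; subst h; simpa using t'.edge_unique e e')
  exit_leaf := by
    rintro p q (⟨u, v, rfl, rfl, e⟩ | ⟨u, v, rfl, rfl, e⟩) x w
      (⟨u', v', h, rfl, e'⟩ | ⟨u', v', h, rfl, e'⟩)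
    · simp at h; subst h; exact t.exit_leaf e _ _ e'
    · simp at h; rw [h.1] at e; exact absurd e (t.not_edge_root _ _)
    · simp at h; rw [h.2] at e; exact absurd e (t'.not_edge_root _ _)
    · simp at h; subst h; exact t'.exit_leaf e _ _ e'

/-- The action of prefixing on morphisms. -/
def preMap (a : A) {t s : SyncTree A} (f : t ⟶ s) : pre a t ⟶ pre a s where
  toFun := Option.map f.toFun
  map_root := rfl
  map_edge := by
    rintro u x v (⟨rfl, rfl, rfl⟩ | ⟨u, v, rfl, rfl, e⟩)
    · exact Or.inl ⟨rfl, rfl, congrArg some f.map_root⟩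
    · exact Or.inr ⟨_, _, rfl, rfl, f.map_edge e⟩

/-- The action of the sum on morphisms. -/
def sumMap {t s t' s' : SyncTree A} (f : t ⟶ s) (f' : t' ⟶ s') : sum t t' ⟶ sum s s' where
  toFun p := ⟨(f.toFun p.1.1, f'.toFun p.1.2), by
    rcases p.2 with h | h
    · exact Or.inl ((congrArg f.toFun h).trans f.map_root)
    · exact Or.inr ((congrArg f'.toFun h).trans f'.map_root)⟩
  map_root := Subtype.ext (Prod.ext f.map_root f'.map_root)
  map_edge := by
    rintro u x v (⟨u, v, rfl, rfl, e⟩ | ⟨u, v, rfl, rfl, e⟩)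
    · exact Or.inl ⟨_, _, Subtype.ext (Prod.ext rfl f'.map_root),
        Subtype.ext (Prod.ext rfl f'.map_root), f.map_edge e⟩
    · exact Or.inr ⟨_, _, Subtype.ext (Prod.ext f.map_root rfl),
        Subtype.ext (Prod.ext f.map_root rfl), f'.map_edge e⟩

end SyncTree

/-- The symbols of the signature `Γ` over `A`. -/
inductive GammaOp (A : Type) : Type
  | zero
  | one
  | plus
  | pre (a : A)

/-- The signature `Γ`: constants `0`, `1`, binary `+`, and a unary symbol for each letter. -/
def Gamma (A : Type) : RankedSignature where
  Op := GammaOp A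
  rank
    | .zero => 0
    | .one => 0
    | .plus => 2
    | .pre _ => 1

namespace SyncTree

variable {A : Type}

/-- The functors interpreting the symbols of `Γ`. -/
def gammaOp : (σ : (Gamma A).Op) → (Fin ((Gamma A).rank σ) → SyncTree A) ⥤ SyncTree A
  | .zero => (Functor.const _).obj (zero A)
  | .one => (Functor.const _).obj (one A)
  | .plus =>
      { obj := fun t => sum (t (0 : Fin 2)) (t (1 : Fin 2))
        map := fun f => sumMap (f (0 : Fin 2)) (f (1 : Fin 2))
        map_id := fun _ => rfl
        map_comp := fun _ _ => rfl }
  | .pre a =>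
      { obj := fun t => pre a (t (0 : Fin 1))
        map := fun f => preMap a (f (0 : Fin 1))
        map_id := fun t => by ext (_ | u) <;> rfl
        map_comp := fun f g => by ext (_ | u) <;> rfl }

/-- The tree without edges is initial. -/
def zeroIsInitial (A : Type) : Limits.IsInitial (zero A) :=
  Limits.IsInitial.ofUniqueHom (fun t => ⟨fun _ => t.root, rfl, fun h => h.elim⟩)
    (fun t f => by ext u; exact f.map_root)


/-! ### Colimits of `ω`-diagrams -/

theorem map_toFun_map_toFun (F : ℕ ⥤ SyncTree A) {n m m' : ℕ} (h : n ⟶ m) (h' : m ⟶ m')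
    (u : (F.obj n).V) : Hom.toFun (F.map h') (Hom.toFun (F.map h) u) =
      Hom.toFun (F.map (h ≫ h')) u := by
  rw [F.map_comp, comp_toFun]

/-- A cocone over an `ω`-diagram is a colimit if its legs are jointly surjective on vertices and
identify only vertices that get identified at some stage. -/
theorem nonempty_isColimit {F : ℕ ⥤ SyncTree A} (c : Limits.Cocone F)
    (hs : ∀ v : c.pt.V, ∃ n u, (c.ι.app n).toFun u = v)
    (hi : ∀ n (u v : (F.obj n).V), (c.ι.app n).toFun u = (c.ι.app n).toFun v →
      ∃ (m : ℕ) (h : n ⟶ m), (F.map h).toFun u = (F.map h).toFun v) :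
    Nonempty (Limits.IsColimit c) := by
  have nat : ∀ (d : Limits.Cocone F) {n m : ℕ} (h : n ⟶ m) (u : (F.obj n).V),
      (d.ι.app m).toFun ((F.map h).toFun u) = (d.ι.app n).toFun u := fun d n m h u => by
    rw [← comp_toFun, d.w]
  choose N U hU using hs
  have key : ∀ (d : Limits.Cocone F) (n : ℕ) (u : (F.obj n).V),
      (d.ι.app _).toFun (U ((c.ι.app n).toFun u)) = (d.ι.app n).toFun u := by
    intro d n u
    set v := (c.ι.app n).toFun u with hv
    have h1 : N v ⟶ max (N v) n := homOfLE (le_max_left _ _)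
    have h2 : n ⟶ max (N v) n := homOfLE (le_max_right _ _)
    obtain ⟨m, h, e⟩ := hi (max (N v) n) ((F.map h1).toFun (U v)) ((F.map h2).toFun u)
      (by rw [nat, nat, hU])
    have := congrArg (d.ι.app m).toFun e
    rwa [nat, nat, nat, nat] at this
  refine ⟨{ desc := fun d => ⟨fun v => (d.ι.app (N v)).toFun (U v), ?_, ?_⟩
            fac := fun d n => by ext u; exact key d n u
            uniq := fun d f hf => ?_ }⟩
  · have := key d 0 (F.obj 0).root
    rw [Hom.map_root, Hom.map_root] at this
    exact this
  · intro p x q e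
    have hq : U q ≠ (F.obj (N q)).root := by
      intro h
      have := hU q
      rw [h, Hom.map_root] at this
      rw [← this] at e
      exact c.pt.not_edge_root _ _ e
    obtain ⟨u, y, e'⟩ := exists_edge _ hq
    have e'' := (c.ι.app (N q)).map_edge e'
    rw [hU] at e''
    obtain ⟨rfl, rfl⟩ := c.pt.edge_unique e e''
    have := (d.ι.app (N q)).map_edge e'
    rwa [← key] at this
  · ext v
    conv_lhs => rw [← hU v]
    rw [← comp_toFun, hf]

/-- Two vertices of an `ω`-diagram are equivalent if they are identified at some stage. -/
def colimitSetoid (F : ℕ ⥤ SyncTree A) : Setoid (Σ n, (F.obj n).V) where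
  r p q := ∃ (m : ℕ) (h : p.1 ⟶ m) (h' : q.1 ⟶ m), (F.map h).toFun p.2 = (F.map h').toFun q.2
  iseqv :=
    { refl := fun p => ⟨p.1, 𝟙 _, 𝟙 _, rfl⟩
      symm := fun ⟨m, h, h', e⟩ => ⟨m, h', h, e.symm⟩
      trans := by
        rintro p q r ⟨m, h, h', e⟩ ⟨m', k, k', e'⟩
        have l : m ⟶ max m m' := homOfLE (le_max_left _ _)
        have l' : m' ⟶ max m m' := homOfLE (le_max_right _ _)
        refine ⟨max m m', h ≫ l, k' ≫ l', ?_⟩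
        have e1 := congrArg (F.map l).toFun e
        have e2 := congrArg (F.map l').toFun e'
        rw [← comp_toFun, ← comp_toFun, ← F.map_comp, ← F.map_comp] at e1 e2
        rw [e1, Subsingleton.elim (h' ≫ l) (k ≫ l'), e2] }

theorem colimit_mk_map (F : ℕ ⥤ SyncTree A) {n m : ℕ} (h : n ⟶ m) (u : (F.obj n).V) :
    (Quotient.mk (colimitSetoid F) ⟨m, (F.map h).toFun u⟩) =
      Quotient.mk (colimitSetoid F) ⟨n, u⟩ :=
  Quotient.sound ⟨m, 𝟙 _, h, by simp⟩

/-- The colimit of an `ω`-diagram of synchronization trees. -/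
def colimitTree (F : ℕ ⥤ SyncTree A) : SyncTree A where
  V := Quotient (colimitSetoid F)
  countable := haveI := fun n => (F.obj n).countable; inferInstance
  root := Quotient.mk _ ⟨0, (F.obj 0).root⟩
  Edge p x q := ∃ n u v, p = Quotient.mk _ ⟨n, u⟩ ∧ q = Quotient.mk _ ⟨n, v⟩ ∧
    (F.obj n).Edge u x v
  existsUnique_path := existsUnique_path_of
    (by
      intro p
      obtain ⟨⟨n, u⟩, rfl⟩ := Quotient.exists_rep p
      obtain ⟨p, hp⟩ := (F.obj n).reach u
      have := hp.map (fun u => Quotient.mk (colimitSetoid F) ⟨n, u⟩)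
        (R' := fun p x q => ∃ n u v, p = Quotient.mk _ ⟨n, u⟩ ∧ q = Quotient.mk _ ⟨n, v⟩ ∧
          (F.obj n).Edge u x v) (fun e => ⟨_, _, _, rfl, rfl, e⟩)
      rw [← (F.map (homOfLE (Nat.zero_le n))).map_root] at this
      rw [colimit_mk_map] at this
      exact ⟨_, this⟩)
    (by
      rintro p x ⟨n, u, v, rfl, h, e⟩
      obtain ⟨m, h, h', h2⟩ := Quotient.exact h
      have := (F.map h').map_edge e
      rw [← h2, Hom.map_root] at this
      exact not_edge_root _ _ _ this)
    (by
      rintro p p' q x x' ⟨n, u, v, rfl, rfl, e⟩ ⟨n', u', v', rfl, h, e'⟩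
      obtain ⟨m, h, h', h2⟩ := Quotient.exact h
      have e1 := (F.map h).map_edge e
      have e2 := (F.map h').map_edge e'
      dsimp only at h2
      rw [← h2] at e2
      obtain ⟨h3, rfl⟩ := edge_unique _ e1 e2
      refine ⟨?_, rfl⟩
      rw [← colimit_mk_map F h, h3, colimit_mk_map])
  exit_leaf := by
    rintro p q ⟨n, u, v, rfl, rfl, e⟩ x w ⟨n', u', v', h, rfl, e'⟩
    obtain ⟨m, h, h', h2⟩ := Quotient.exact h
    have e1 := (F.map h).map_edge e
    have e2 := (F.map h').map_edge e'
    dsimp only at h2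
    rw [← h2] at e2
    exact exit_leaf _ e1 _ _ e2

/-- The colimit cocone of an `ω`-diagram of synchronization trees. -/
def colimitTreeCocone (F : ℕ ⥤ SyncTree A) : Limits.Cocone F where
  pt := colimitTree F
  ι :=
    { app := fun n => ⟨fun u => Quotient.mk _ ⟨n, u⟩, by
          rw [← (F.map (homOfLE (Nat.zero_le n))).map_root, colimit_mk_map]; rfl,
        fun e => ⟨_, _, _, rfl, rfl, e⟩⟩
      naturality := fun n m h => by ext u; exact colimit_mk_map F h u }

theorem colimitTreeCocone_surj (F : ℕ ⥤ SyncTree A) (v : (colimitTreeCocone F).pt.V) :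
    ∃ n u, ((colimitTreeCocone F).ι.app n).toFun u = v := by
  obtain ⟨⟨n, u⟩, rfl⟩ := Quotient.exists_rep v
  exact ⟨n, u, rfl⟩

theorem colimitTreeCocone_inj (F : ℕ ⥤ SyncTree A) (n : ℕ) (u v : (F.obj n).V)
    (h : ((colimitTreeCocone F).ι.app n).toFun u = ((colimitTreeCocone F).ι.app n).toFun v) :
    ∃ (m : ℕ) (h : n ⟶ m), (F.map h).toFun u = (F.map h).toFun v := by
  obtain ⟨m, k, k', e⟩ := Quotient.exact h
  rw [Subsingleton.elim k' k] at e
  exact ⟨m, k, e⟩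

theorem hasColimitsOfShape_nat (A : Type) : Limits.HasColimitsOfShape ℕ (SyncTree A) where
  has_colimit F := ⟨⟨⟨colimitTreeCocone F, (nonempty_isColimit _ (colimitTreeCocone_surj F)
    (colimitTreeCocone_inj F)).some⟩⟩⟩

/-- The colimit cocone of an `ω`-diagram of tuples of synchronization trees. -/
def colimitTupleCocone {r : ℕ} (F : ℕ ⥤ (Fin r → SyncTree A)) : Limits.Cocone F :=
  pi.coconeOfCoconeCompEval (fun i => colimitTreeCocone (F ⋙ Pi.eval _ i))

theorem nonempty_isColimit_tuple {r : ℕ} (F : ℕ ⥤ (Fin r → SyncTree A)) :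
    Nonempty (Limits.IsColimit (colimitTupleCocone F)) :=
  ⟨pi.coconeOfCoconeEvalIsColimit (fun _ => (nonempty_isColimit _ (colimitTreeCocone_surj _)
    (colimitTreeCocone_inj _)).some)⟩

theorem preservesColimitsOfShape_nat {r : ℕ} (G : (Fin r → SyncTree A) ⥤ SyncTree A)
    (hs : ∀ (F : ℕ ⥤ (Fin r → SyncTree A)) (v : (G.obj (colimitTupleCocone F).pt).V),
      ∃ n u, (G.map ((colimitTupleCocone F).ι.app n)).toFun u = v)
    (hi : ∀ (F : ℕ ⥤ (Fin r → SyncTree A)) n (u v : (G.obj (F.obj n)).V),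
      (G.map ((colimitTupleCocone F).ι.app n)).toFun u =
        (G.map ((colimitTupleCocone F).ι.app n)).toFun v →
      ∃ (m : ℕ) (h : n ⟶ m), (G.map (F.map h)).toFun u = (G.map (F.map h)).toFun v) :
    Limits.PreservesColimitsOfShape ℕ G where
  preservesColimit {F} :=
    Limits.preservesColimit_of_preserves_colimit_cocone (nonempty_isColimit_tuple F).some
      (nonempty_isColimit (G.mapCocone (colimitTupleCocone F)) (hs F) (hi F)).some

theorem gammaOp_continuous :
    ∀ σ : (Gamma A).Op, Limits.PreservesColimitsOfShape ℕ (gammaOp σ)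
  | .zero => preservesColimitsOfShape_nat _ (fun _ v => ⟨0, v, rfl⟩)
      (fun _ n _ _ h => ⟨n, 𝟙 _, h⟩)
  | .one => preservesColimitsOfShape_nat _ (fun _ v => ⟨0, v, rfl⟩)
      (fun _ n _ _ h => ⟨n, 𝟙 _, h⟩)
  | .plus => by
      refine preservesColimitsOfShape_nat (r := 2) _ ?_ ?_
      · rintro F ⟨⟨u, v⟩, (h | h)⟩
        · obtain ⟨n, w, rfl⟩ := colimitTreeCocone_surj (F ⋙ Pi.eval _ 1) v
          refine ⟨n, ⟨(_, w), Or.inl rfl⟩, Subtype.ext (Prod.ext ?_ rfl)⟩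
          exact (((colimitTreeCocone (F ⋙ Pi.eval _ 0)).ι.app n).map_root).trans h.symm
        · obtain ⟨n, w, rfl⟩ := colimitTreeCocone_surj (F ⋙ Pi.eval _ 0) u
          refine ⟨n, ⟨(w, _), Or.inr rfl⟩, Subtype.ext (Prod.ext rfl ?_)⟩
          exact (((colimitTreeCocone (F ⋙ Pi.eval _ 1)).ι.app n).map_root).trans h.symm
      · rintro F n u v h
        have h0 := congrArg (fun p => p.1.1) h
        have h1 := congrArg (fun p => p.1.2) h
        obtain ⟨m, k, e⟩ := colimitTreeCocone_inj (F ⋙ Pi.eval _ 0) n u.1.1 v.1.1 h0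
        obtain ⟨m', k', e'⟩ := colimitTreeCocone_inj (F ⋙ Pi.eval _ 1) n u.1.2 v.1.2 h1
        have l : m ⟶ max m m' := homOfLE (le_max_left _ _)
        have l' : m' ⟶ max m m' := homOfLE (le_max_right _ _)
        refine ⟨max m m', k ≫ l, Subtype.ext (Prod.ext ?_ ?_)⟩
        · have := congrArg ((F ⋙ Pi.eval _ 0).map l).toFun e
          exact ((map_toFun_map_toFun (F ⋙ Pi.eval _ 0) k l u.1.1).symm.trans this).trans
            (map_toFun_map_toFun (F ⋙ Pi.eval _ 0) k l v.1.1)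
        · have := congrArg ((F ⋙ Pi.eval _ 1).map l').toFun e'
          rw [Subsingleton.elim (k ≫ l) (k' ≫ l')]
          exact ((map_toFun_map_toFun (F ⋙ Pi.eval _ 1) k' l' u.1.2).symm.trans this).trans
            (map_toFun_map_toFun (F ⋙ Pi.eval _ 1) k' l' v.1.2)
  | .pre a => by
      refine preservesColimitsOfShape_nat (r := 1) _ ?_ ?_
      · rintro F (_ | u)
        · exact ⟨0, none, rfl⟩
        · obtain ⟨n, w, rfl⟩ := colimitTreeCocone_surj (F ⋙ Pi.eval _ 0) u
          exact ⟨n, some w, rfl⟩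
      · rintro F n (_ | u) (_ | v) h
        · exact ⟨n, 𝟙 _, rfl⟩
        · cases h
        · cases h
        · obtain ⟨m, k, e⟩ := colimitTreeCocone_inj (F ⋙ Pi.eval _ 0) n u v (Option.some.inj h)
          exact ⟨m, k, congrArg some e⟩

/-- The category of synchronization trees as a continuous categorical `Γ`-algebra. -/
def gammaAlgebra (A : Type) : ContinuousAlgebra (Gamma A) (SyncTree A) where
  bot := zero A
  botIsInitial := zeroIsInitial A
  hasColimits := hasColimitsOfShape_nat A
  op := gammaOp
  continuous := gammaOp_continuous

/-- `Γ`-algebraic synchronization trees. -/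
def IsGammaAlgebraic (t : SyncTree A) : Prop :=
  IsAlgebraicObject (gammaAlgebra A) t

/-! ### Language equivalence -/

/-- The words over `A` that label a path from the root to the source of an exit edge. -/
def pathLanguage (t : SyncTree A) : Language A :=
  {w | ∃ p u v, IsPath t.Edge t.root p u ∧ p.map Prod.fst = w.map some ∧ t.Edge u none v}

/-- Language equivalence of synchronization trees. -/
def LanguageEquivalent (t t' : SyncTree A) : Prop :=
  t.pathLanguage = t'.pathLanguage

end SyncTree

/-! ## Unfoldings of labelled transition systems, and the bag -/

/-- A labelled transition system with a start state and a set of final states. -/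
structure LTS (A : Type) where
  State : Type
  countable : Countable State
  start : State
  Final : State → Prop
  Step : State → A → State → Prop

namespace LTS

variable {A : Type}

/-- The edge-labelled graph of a transition system. It has an extra vertex `none`, and an
(implicit) edge labelled `ex` from every final state to `none`. -/
inductive GraphEdge (G : LTS A) : Option G.State → Option A → Option G.State → Prop
  | step {s s' : G.State} {a : A} : G.Step s a s' → GraphEdge G (some s) (some a) (some s')
  | exit {s : G.State} : G.Final s → GraphEdge G (some s) none none

/-- The unfolding from the start state: its vertices are the paths from the start state, and its
edges are the extensions of a path by one edge. -/
def unfolding [Countable A] (G : LTS A) : SyncTree A where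
  V := {p : List (Option A × Option G.State) // ∃ s, IsPath G.GraphEdge (some G.start) p s}
  countable := haveI := G.countable; inferInstance
  root := ⟨[], _, .nil _⟩
  Edge p x q := ∃ s, q.1 = p.1 ++ [(x, s)]
  existsUnique_path := existsUnique_path_of
    (by
      rintro ⟨p, hp⟩
      induction p using List.reverseRecOn with
      | nil => exact ⟨[], .nil _⟩
      | append_singleton p y ih =>
        have hp' : ∃ s, IsPath G.GraphEdge (some G.start) p s := by
          obtain ⟨s, hs⟩ := hp
          obtain ⟨_, v, hv, _⟩ := hs.of_append_singleton
          exact ⟨v, hv⟩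
        obtain ⟨q, hq⟩ := ih hp'
        exact ⟨_, hq.append_singleton ⟨y.2, rfl⟩⟩)
    (by rintro p x ⟨s, h⟩; simp at h)
    (by
      rintro p p' q x x' ⟨s, h⟩ ⟨s', h'⟩
      have := List.append_inj' (h.symm.trans h') rfl
      simp only [List.cons.injEq, Prod.mk.injEq, and_true] at this
      exact ⟨Subtype.ext this.1, this.2.1⟩)
  exit_leaf := by
    rintro p q ⟨s, h⟩ x r ⟨s', h'⟩
    obtain ⟨z, hz⟩ := r.2
    rw [h'] at hz
    obtain ⟨-, v, hv, e⟩ := hz.of_append_singleton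
    rw [h] at hv
    obtain ⟨rfl, v', -, e'⟩ := hv.of_append_singleton
    cases e'
    cases e

/-- The steps of the bag over two values: in the state `(i, j)` it contains `i` items of the first
and `j` items of the second kind. An item of the first kind is put in by `a` and taken out by `b`,
and an item of the second kind is put in by `c` and taken out by `d`. -/
inductive BagStep (a b c d : A) : ℕ × ℕ → A → ℕ × ℕ → Prop
  | a (i j : ℕ) : BagStep a b c d (i, j) a (i + 1, j)
  | b (i j : ℕ) : BagStep a b c d (i + 1, j) b (i, j)
  | c (i j : ℕ) : BagStep a b c d (i, j) c (i, j + 1)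
  | d (i j : ℕ) : BagStep a b c d (i, j + 1) d (i, j)

/-- The bag over two values, which starts empty and may terminate exactly when it is empty. -/
def bag (a b c d : A) : LTS A where
  State := ℕ × ℕ
  countable := inferInstance
  start := (0, 0)
  Final s := s = (0, 0)
  Step := BagStep a b c d

end LTS

/-- The synchronization tree of the bag. -/
def bagTree {A : Type} [Countable A] (a b c d : A) : SyncTree A :=
  (LTS.bag a b c d).unfolding

/-! ## Path languages of the basic operations -/

namespace SyncTree

variable {A : Type}

/-! The path language of a `Γ`-algebraic tree is generated in a context-free way. A word on a path
through the tree of a term either ends at an exit edge or reaches an occurrence of a variable. At a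
call of `Fⱼ`, a word from the right-hand side of `Fⱼ` to its variable `i` is followed by a word from
the `i`-th argument. `Derives` records these rules, and `mem_pathLanguage_solution` identifies the
path language with the derivable words. The nonterminals are the finitely many `nodes`: a subterm of
a right-hand side together with a target (a variable or the exit).

Every word of the bag has as many `a` as `b` and as many `c` as `d`. If a node is used in a
derivation of such words, any two words it derives can replace each other in the same context, so
they have the same excess of `a` over `b` and of `c` over `d`. Hence each node determines one value
of `imbalance`, and finiteness of the nodes gives a bound `M` on these values
(`exists_bounded_factor`). Cutting a derivation of a long word at a suitable node
(`Derives.hasNodeFactor`) produces factors with length in `(B, 2 * B]` for any `B > 0`, still with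
imbalance at most `M`.

The word `aⁿcⁿbⁿdⁿ` belongs to the bag, but a factor of length at most `n` cannot contain both `a`
and `b`, nor both `c` and `d`, so its imbalance equals its length (`imbalance_eq_length`). Taking `B
= M + 1` and `n = 2 * B` is contradictory. -/

/-- Morphisms preserve and reflect the labels of the paths from the root. -/
theorem Hom.path_labels {t s : SyncTree A} (f : t ⟶ s) {u : t.V} {p : List (Option A × s.V)}
    (hp : IsPath s.Edge s.root p (f.toFun u)) :
    ∃ q, IsPath t.Edge t.root q u ∧ q.map Prod.fst = p.map Prod.fst := by
  obtain ⟨q, hq⟩ := t.reach u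
  have h := hq.map f.toFun f.map_edge
  rw [f.map_root] at h
  rw [(s.existsUnique_path _).unique hp h]
  exact ⟨q, hq, by simp⟩

theorem pathLanguage_mono {t s : SyncTree A} (f : t ⟶ s) : t.pathLanguage ≤ s.pathLanguage := by
  rintro w ⟨p, u, v, hp, hw, e⟩
  have h := hp.map f.toFun f.map_edge
  rw [f.map_root] at h
  exact ⟨_, _, _, h, by rw [← hw, List.map_map]; rfl, f.map_edge e⟩

theorem pathLanguage_eq_of_iso {t s : SyncTree A} (f : t ≅ s) :
    t.pathLanguage = s.pathLanguage :=
  le_antisymm (pathLanguage_mono f.hom) (pathLanguage_mono f.inv)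

/-- Root paths are unique, so an accepting path of `s` pulls back along `f` as soon as its final
exit edge starts at the image of a vertex that already has an exit edge in `t`. -/
theorem mem_pathLanguage_of_hom {t s : SyncTree A} (f : t ⟶ s) {u v : t.V}
    {p : List (Option A × s.V)} {w : List A} (hp : IsPath s.Edge s.root p (f.toFun u))
    (hw : p.map Prod.fst = w.map some) (e : t.Edge u none v) : w ∈ t.pathLanguage := by
  obtain ⟨q, hq, h⟩ := Hom.path_labels f hp
  exact ⟨q, u, v, hq, h.trans hw, e⟩

theorem notMem_pathLanguage_zero (w : List A) : w ∉ (zero A).pathLanguage := by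
  rintro ⟨_, _, _, _, _, ⟨⟩⟩

theorem mem_pathLanguage_one {w : List A} : w ∈ (one A).pathLanguage ↔ w = [] := by
  constructor
  · rintro ⟨p, u, v, hp, hw, rfl, -, rfl⟩
    rw [((one A).existsUnique_path false).unique hp (.nil _)] at hw
    simpa using hw.symm
  · rintro rfl
    exact ⟨[], false, true, .nil _, rfl, rfl, rfl, rfl⟩

/-- The left summand as a subtree. -/
def inl (t t' : SyncTree A) : t ⟶ sum t t' where
  toFun u := ⟨(u, t'.root), Or.inr rfl⟩
  map_root := rfl
  map_edge e := Or.inl ⟨_, _, rfl, rfl, e⟩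

/-- The right summand as a subtree. -/
def inr (t t' : SyncTree A) : t' ⟶ sum t t' where
  toFun u := ⟨(t.root, u), Or.inl rfl⟩
  map_root := rfl
  map_edge e := Or.inr ⟨_, _, rfl, rfl, e⟩

theorem mem_pathLanguage_sum {t t' : SyncTree A} {w : List A} :
    w ∈ (sum t t').pathLanguage ↔ w ∈ t.pathLanguage ∨ w ∈ t'.pathLanguage := by
  constructor
  · rintro ⟨p, _, _, hp, hw, ⟨u, v, rfl, rfl, e⟩ | ⟨u, v, rfl, rfl, e⟩⟩
    · exact Or.inl (mem_pathLanguage_of_hom (inl t t') hp hw e)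
    · exact Or.inr (mem_pathLanguage_of_hom (inr t t') hp hw e)
  · rintro (h | h)
    · exact pathLanguage_mono (inl t t') h
    · exact pathLanguage_mono (inr t t') h

theorem isPath_pre (a : A) {t : SyncTree A} {p : List (Option A × t.V)} {u : t.V}
    (h : IsPath t.Edge t.root p u) :
    IsPath (pre a t).Edge none ((some a, some t.root) :: p.map fun y => (y.1, some y.2))
      (some u) :=
  .cons (Or.inl ⟨rfl, rfl, rfl⟩) (h.map some fun e => Or.inr ⟨_, _, rfl, rfl, e⟩)

theorem mem_pathLanguage_pre {a : A} {t : SyncTree A} {w : List A} :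
    w ∈ (pre a t).pathLanguage ↔ ∃ v ∈ t.pathLanguage, w = a :: v := by
  constructor
  · rintro ⟨p, _, _, hp, hw, ⟨-, ⟨⟩, -⟩ | ⟨u, v, rfl, rfl, e⟩⟩
    obtain ⟨q, hq⟩ := t.reach u
    rw [((pre a t).existsUnique_path _).unique hp (isPath_pre a hq)] at hw
    cases w with
    | nil => simp at hw
    | cons x w =>
      simp only [List.map_cons, List.map_map, List.cons.injEq, Option.some.injEq] at hw
      exact ⟨w, ⟨q, u, v, hq, hw.2, e⟩, by rw [hw.1]⟩
  · rintro ⟨v, ⟨p, u, u', hp, hw, e⟩, rfl⟩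
    refine ⟨_, some u, some u', isPath_pre a hp, ?_, Or.inr ⟨_, _, rfl, rfl, e⟩⟩
    simp only [List.map_cons, List.map_map, ← hw]
    rfl

/-- An edge of the explicit colimit `colimitTree` comes from some stage, and that stage, being a
tree, already contains the whole path from the root to it. -/
theorem mem_pathLanguage_of_isColimit {F : ℕ ⥤ SyncTree A} {c : Limits.Cocone F}
    (hc : Limits.IsColimit c) {w : List A} :
    w ∈ c.pt.pathLanguage ↔ ∃ n, w ∈ (F.obj n).pathLanguage := by
  constructor
  · intro h
    have h' := pathLanguage_mono (hc.desc (colimitTreeCocone F)) h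
    obtain ⟨p, _, _, hp, hw, n, u, v, rfl, rfl, e⟩ := h'
    exact ⟨n, mem_pathLanguage_of_hom ((colimitTreeCocone F).ι.app n) hp hw e⟩
  · rintro ⟨n, h⟩
    exact pathLanguage_mono (c.ι.app n) h

end SyncTree

/-! ## The path language of the initial solution -/

namespace SchemeTerm

variable {A : Type} {n : ℕ} {k : Fin n → ℕ}

/-- `Derives rhs t o w`: in the tree denoted by `t`, with the functor variables interpreted by the
initial solution of the system `rhs`, the word `w` labels a path from the root to an occurrence of
the variable `i` if `o = some i`, and to the source of an exit edge if `o = none`. -/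
inductive Derives (rhs : (j : Fin n) → SchemeTerm (Gamma A) k (k j)) :
    {m : ℕ} → SchemeTerm (Gamma A) k m → Option (Fin m) → List A → Prop
  | var {m : ℕ} (i : Fin m) : Derives rhs (.var i) (some i) []
  | one {m : ℕ} (ts) : Derives rhs (m := m) (.op (S := Gamma A) GammaOp.one ts) none []
  | plus {m : ℕ} {o : Option (Fin m)} {w : List A} (ts) (i : Fin 2) :
      Derives rhs (ts i) o w → Derives rhs (.op (S := Gamma A) GammaOp.plus ts) o w
  | pre {m : ℕ} {o : Option (Fin m)} {w : List A} (x : A) (ts) :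
      Derives rhs (ts (0 : Fin 1)) o w →
        Derives rhs (.op (S := Gamma A) (GammaOp.pre x) ts) o (x :: w)
  | callExit {m : ℕ} {w : List A} (j : Fin n) (ts : Fin (k j) → SchemeTerm (Gamma A) k m) :
      Derives rhs (rhs j) none w → Derives rhs (.call j ts) none w
  | call {m : ℕ} {o : Option (Fin m)} {w w' : List A} (j : Fin n) (ts) (i : Fin (k j)) :
      Derives rhs (rhs j) (some i) w → Derives rhs (ts i) o w' →
        Derives rhs (.call j ts) o (w ++ w')

end SchemeTerm

namespace RecursionScheme

open SyncTree SchemeTerm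

variable {A : Type} (E : RecursionScheme (Gamma A))

/-- The words that `t` derives when its variables stand for the languages `L`. -/
def DerivesWith {m : ℕ} (t : SchemeTerm (Gamma A) E.k m) (L : Fin m → Language A)
    (w : List A) : Prop :=
  Derives E.rhs t none w ∨ ∃ i u v, Derives E.rhs t (some i) u ∧ v ∈ L i ∧ w = u ++ v

/-- Soundness of one evaluation, by induction on the term. At a call, `hf` splits off a word of the
right-hand side, and the remainder is a word of an argument, to which the induction hypothesis
applies. -/
theorem derivesWith_of_mem_pathLanguage_eval (f : Interpretation E.k (SyncTree A))
    (hf : ∀ j x w, w ∈ ((f j).obj x).pathLanguage →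
      E.DerivesWith (E.rhs j) (fun i => (x i).pathLanguage) w) {m : ℕ}
    (t : SchemeTerm (Gamma A) E.k m) (x : Fin m → SyncTree A) (w : List A)
    (h : w ∈ (((t.eval (gammaAlgebra A)).obj f).obj x).pathLanguage) :
    E.DerivesWith t (fun i => (x i).pathLanguage) w := by
  induction t generalizing w with
  | var i => exact Or.inr ⟨i, [], w, .var i, h, rfl⟩
  | op σ ts ih =>
    cases σ with
    | zero => exact absurd h (notMem_pathLanguage_zero w)
    | one =>
      obtain rfl := mem_pathLanguage_one.1 h
      exact Or.inl (.one ts)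
    | plus =>
      rcases mem_pathLanguage_sum.1 h with h | h
      · rcases ih (0 : Fin 2) w h with hd | ⟨i, u, v, hd, hv, rfl⟩
        · exact Or.inl (.plus ts 0 hd)
        · exact Or.inr ⟨i, u, v, .plus ts 0 hd, hv, rfl⟩
      · rcases ih (1 : Fin 2) w h with hd | ⟨i, u, v, hd, hv, rfl⟩
        · exact Or.inl (.plus ts 1 hd)
        · exact Or.inr ⟨i, u, v, .plus ts 1 hd, hv, rfl⟩
    | pre a =>
      obtain ⟨w, hw, rfl⟩ := mem_pathLanguage_pre.1 h
      rcases ih (0 : Fin 1) w hw with hd | ⟨i, u, v, hd, hv, rfl⟩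
      · exact Or.inl (.pre a ts hd)
      · exact Or.inr ⟨i, _, v, .pre a ts hd, hv, rfl⟩
  | call j ts ih =>
    rcases hf j _ w h with hd | ⟨i, u, v, hd, hv, rfl⟩
    · exact Or.inl (.callExit j ts hd)
    · rcases ih i v hv with h' | ⟨i', u', v', h', hv', rfl⟩
      · exact Or.inl (.call j ts i hd h')
      · exact Or.inr ⟨i', _, v', .call j ts i hd h', hv', (List.append_assoc _ _ _).symm⟩

theorem derivesWith_of_mem_pathLanguage_approx (l : ℕ) (j : Fin (E.n + 1))
    (x : Fin (E.k j) → SyncTree A) (w : List A)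
    (h : w ∈ ((E.approx (gammaAlgebra A) l j).obj x).pathLanguage) :
    E.DerivesWith (E.rhs j) (fun i => (x i).pathLanguage) w := by
  induction l generalizing j w with
  | zero => exact absurd h (notMem_pathLanguage_zero w)
  | succ l ih => exact E.derivesWith_of_mem_pathLanguage_eval _ ih (E.rhs j) x w h

/-- Completeness, by induction on the derivation. The continuation `v` is read in the tree
substituted for the variable reached, and is empty at an exit. The claim is made for all `l ≥ l₀` so
that the stages needed by the two premises of a call can be merged. -/
theorem exists_mem_pathLanguage_eval_of_derives {m : ℕ} {t : SchemeTerm (Gamma A) E.k m}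
    {o : Option (Fin m)} {w : List A} (h : Derives E.rhs t o w) :
    ∃ l₀, ∀ l ≥ l₀, ∀ (x : Fin m → SyncTree A) (v : List A),
      (∀ i ∈ o, v ∈ (x i).pathLanguage) → (o = none → v = []) →
        w ++ v ∈ (((t.eval (gammaAlgebra A)).obj
          (E.approx (gammaAlgebra A) l)).obj x).pathLanguage := by
  induction h with
  | var i => exact ⟨0, fun l _ x v hv _ => hv i rfl⟩
  | one ts => exact ⟨0, fun l _ x v _ hv => mem_pathLanguage_one.2 (hv rfl)⟩
  | plus ts i _ ih =>
    obtain ⟨l₀, ih⟩ := ih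
    refine ⟨l₀, fun l hl x v h1 h2 => mem_pathLanguage_sum.2 ?_⟩
    have := ih l hl x v h1 h2
    match i with
    | 0 => exact Or.inl this
    | 1 => exact Or.inr this
  | pre a ts _ ih =>
    obtain ⟨l₀, ih⟩ := ih
    exact ⟨l₀, fun l hl x v h1 h2 => mem_pathLanguage_pre.2 ⟨_, ih l hl x v h1 h2, rfl⟩⟩
  | callExit j ts _ ih =>
    obtain ⟨l₀, ih⟩ := ih
    refine ⟨l₀ + 1, fun l hl x v h1 h2 => ?_⟩
    -- At stage `l + 1` a call of `Fⱼ` is by definition the right-hand side `rhs j` evaluated at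
    -- stage `l`, so each call costs one stage.
    obtain ⟨l, rfl⟩ : ∃ l', l = l' + 1 := ⟨l - 1, by omega⟩
    exact ih l (by omega) _ v (by simp) fun _ => h2 rfl
  | call j ts i _ _ ih ih' =>
    obtain ⟨l₀, ih⟩ := ih
    obtain ⟨l₀', ih'⟩ := ih'
    refine ⟨max (l₀ + 1) l₀', fun l hl x v h1 h2 => ?_⟩
    have h3 := ih' l (le_of_max_le_right hl) x v h1 h2
    obtain ⟨l, rfl⟩ : ∃ l', l = l' + 1 := ⟨l - 1, by omega⟩
    rw [List.append_assoc]
    exact ih l (by omega) _ _ (by rintro _ ⟨⟩; exact h3) (by simp)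

/-- If the first functor variable has rank `0`, its right-hand side derives exactly the path
language of the first component of the initial solution. -/
theorem mem_pathLanguage_solution (h0 : E.k 0 = 0) (x : Fin (E.k 0) → SyncTree A) (w : List A) :
    w ∈ ((E.solution (gammaAlgebra A) 0).obj x).pathLanguage ↔
      Derives E.rhs (E.rhs 0) none w := by
  have := (gammaAlgebra A).hasColimits
  -- Colimits of functors are computed pointwise, so evaluation at `x` preserves this one.
  have key := mem_pathLanguage_of_isColimit (w := w) (Limits.isColimitOfPreserves
    ((evaluation _ _).obj x) (Limits.colimit.isColimit
      (E.approxDiagram (gammaAlgebra A) ⋙ Pi.eval _ 0)))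
  refine key.trans ⟨?_, fun h => ?_⟩
  · rintro ⟨l, h⟩
    rcases E.derivesWith_of_mem_pathLanguage_approx l 0 x w h with h | ⟨i, -⟩
    · exact h
    · exact (Fin.cast h0 i).elim0
  · obtain ⟨l, hl⟩ := E.exists_mem_pathLanguage_eval_of_derives h
    have := hl l le_rfl x [] (by simp) (by simp)
    rw [List.append_nil] at this
    exact ⟨l + 1, this⟩

end RecursionScheme

/-! ## Finiteness of the derivation nodes -/

namespace SchemeTerm

/-- The subterms of a term, including the term itself. -/
def subterms {S : RankedSignature} {n : ℕ} {k : Fin n → ℕ} {m : ℕ} :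
    SchemeTerm S k m → Set (SchemeTerm S k m)
  | .var i => {.var i}
  | .op σ ts => insert (.op σ ts) (⋃ i, (ts i).subterms)
  | .call j ts => insert (.call j ts) (⋃ i, (ts i).subterms)

section

variable {S : RankedSignature} {n : ℕ} {k : Fin n → ℕ} {m : ℕ}

theorem finite_subterms (t : SchemeTerm S k m) : t.subterms.Finite := by
  induction t with
  | var i => exact Set.finite_singleton _
  | op σ ts ih => exact (Set.finite_iUnion ih).insert _
  | call j ts ih => exact (Set.finite_iUnion ih).insert _

theorem self_mem_subterms (t : SchemeTerm S k m) : t ∈ t.subterms := by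
  cases t <;> simp [subterms]

theorem subterms_subset {s t : SchemeTerm S k m} (h : s ∈ t.subterms) :
    s.subterms ⊆ t.subterms := by
  induction t with
  | var i => rw [Set.mem_singleton_iff.1 h]
  | op σ ts ih =>
    rcases h with rfl | h
    · exact subset_rfl
    · obtain ⟨i, hi⟩ := Set.mem_iUnion.1 h
      exact fun x hx => Or.inr (Set.mem_iUnion.2 ⟨i, ih i hi hx⟩)
  | call j ts ih =>
    rcases h with rfl | h
    · exact subset_rfl
    · obtain ⟨i, hi⟩ := Set.mem_iUnion.1 h
      exact fun x hx => Or.inr (Set.mem_iUnion.2 ⟨i, ih i hi hx⟩)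

theorem arg_mem_subterms_op {t : SchemeTerm S k m} {σ : S.Op}
    {ts : Fin (S.rank σ) → SchemeTerm S k m} (h : .op σ ts ∈ t.subterms) (i : Fin (S.rank σ)) :
    ts i ∈ t.subterms :=
  subterms_subset h (Or.inr (Set.mem_iUnion.2 ⟨i, self_mem_subterms _⟩))

theorem arg_mem_subterms_call {t : SchemeTerm S k m} {j : Fin n}
    {ts : Fin (k j) → SchemeTerm S k m} (h : .call j ts ∈ t.subterms) (i : Fin (k j)) :
    ts i ∈ t.subterms :=
  subterms_subset h (Or.inr (Set.mem_iUnion.2 ⟨i, self_mem_subterms _⟩))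

end

/-! ### Nodes as the nonterminals of a finite grammar -/

variable {A : Type} {n : ℕ} {k : Fin n → ℕ} (rhs : (j : Fin n) → SchemeTerm (Gamma A) k (k j))

/-- The pairs of a subterm of a right-hand side and a variable of its equation or an exit. -/
def nodes : Set (Σ j : Fin n, SchemeTerm (Gamma A) k (k j) × Option (Fin (k j))) :=
  {X | X.2.1 ∈ (rhs X.1).subterms}

theorem finite_nodes : (nodes rhs).Finite := by
  have h : nodes rhs = ⋃ j, Sigma.mk j '' ((rhs j).subterms ×ˢ Set.univ) := by
    ext ⟨j, t, o⟩
    simp only [nodes, Set.mem_ofPred_eq, Set.mem_iUnion, Set.mem_image, Set.mem_prod,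
      Set.mem_univ, and_true]
    constructor
    · exact fun h => ⟨j, (t, o), h, rfl⟩
    · rintro ⟨_, _, h, ⟨⟩⟩
      exact h
  rw [h]
  exact Set.finite_iUnion fun j => ((finite_subterms _).prod Set.finite_univ).image _

/-- The word `w` derived from `t` has a factor of length in `(B, 2 * B]` that is derived from a
node and may be replaced by every other word derived from that node. -/
def HasNodeFactor (B : ℕ) {m : ℕ} (t : SchemeTerm (Gamma A) k m) (o : Option (Fin m))
    (w : List A) : Prop :=
  ∃ X ∈ nodes rhs, ∃ u v y, w = u ++ v ++ y ∧ B < v.length ∧ v.length ≤ 2 * B ∧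
    Derives rhs X.2.1 X.2.2 v ∧
    ∀ v', Derives rhs X.2.1 X.2.2 v' → Derives rhs t o (u ++ v' ++ y)

/-! ### Factors of moderate length -/

variable {rhs} {B : ℕ} {m m' : ℕ} {t : SchemeTerm (Gamma A) k m} {o : Option (Fin m)}
  {t' : SchemeTerm (Gamma A) k m'} {o' : Option (Fin m')} {w : List A}

theorem HasNodeFactor.context (h : HasNodeFactor rhs B t o w) (u y : List A)
    (h' : ∀ v, Derives rhs t o v → Derives rhs t' o' (u ++ v ++ y)) :
    HasNodeFactor rhs B t' o' (u ++ w ++ y) := by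
  obtain ⟨X, hX, u', v, y', rfl, h1, h2, hv, h3⟩ := h
  refine ⟨X, hX, u ++ u', v, y' ++ y, by simp, h1, h2, hv, fun v' hv' => ?_⟩
  simpa using h' _ (h3 v' hv')

theorem HasNodeFactor.of_length_le {j : Fin n} {t : SchemeTerm (Gamma A) k (k j)}
    {o : Option (Fin (k j))}
    (ht : t ∈ (rhs j).subterms) (hd : Derives rhs t o w) (h : B < w.length)
    (h' : w.length ≤ 2 * B) : HasNodeFactor rhs B t o w :=
  ⟨⟨j, t, o⟩, ht, [], w, [], by simp, h, h', hd, by simp⟩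

/-- Descend in the derivation, keeping a node whose word is longer than `B`, until that word has
length at most `2 * B`. A word longer than `2 * B` stays longer than `B` after losing one letter, as
`B > 0`, and if it is split in two, one part is longer than `B`. The equation `hm` lets `m` vary in
the induction, since a call passes to a right-hand side with other variables. -/
theorem Derives.hasNodeFactor (hB : 0 < B) (h : Derives rhs t o w) {j : Fin n} (hm : m = k j)
    (ht : hm ▸ t ∈ (rhs j).subterms) (hw : B < w.length) : HasNodeFactor rhs B t o w := by
  induction h generalizing j with
  | var i => simp at hw
  | one ts => simp at hw
  | plus ts i h ih =>
    subst hm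
    simpa using (ih rfl (arg_mem_subterms_op ht i) hw).context [] []
      (fun v hv => by simpa using Derives.plus ts i hv)
  | @pre _ _ w x ts h ih =>
    subst hm
    by_cases hw' : (x :: w).length ≤ 2 * B
    · exact .of_length_le ht (.pre x ts h) hw hw'
    · rw [List.length_cons] at hw'
      simpa using (ih rfl (arg_mem_subterms_op ht (0 : Fin 1)) (by omega)).context [x] []
        (fun v hv => by simpa using Derives.pre x ts hv)
  | callExit j' ts h ih =>
    simpa using (ih rfl (self_mem_subterms (rhs j')) hw).context [] []
      (fun v hv => by simpa using Derives.callExit j' ts hv)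
  | @call _ o w w' j' ts i h h' ih ih' =>
    subst hm
    by_cases hw' : (w ++ w').length ≤ 2 * B
    · exact .of_length_le ht (.call j' ts i h h') hw hw'
    · rw [List.length_append] at hw'
      by_cases hw1 : B < w.length
      · simpa using (ih rfl (self_mem_subterms (rhs j')) hw1).context [] w'
          (fun v hv => by simpa using Derives.call j' ts i hv h')
      · simpa using (ih' rfl (arg_mem_subterms_call ht i) (by omega)).context w []
          (fun v hv => by simpa using Derives.call j' ts i h hv)

/-- If two words that may replace each other as factors of derived words always have the same value
under `f`, then every long derived word has a factor of moderate length on which `f` is bounded. -/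
theorem exists_bounded_factor (rhs : (j : Fin n) → SchemeTerm (Gamma A) k (k j)) (j : Fin n)
    (o : Option (Fin (k j))) (f : List A → ℕ)
    (hf : ∀ u v v' y, Derives rhs (rhs j) o (u ++ v ++ y) →
      Derives rhs (rhs j) o (u ++ v' ++ y) → f v = f v') :
    ∃ M, ∀ B, 0 < B → ∀ w, Derives rhs (rhs j) o w → B < w.length →
      ∃ u v y, w = u ++ v ++ y ∧ B < v.length ∧ v.length ≤ 2 * B ∧ f v ≤ M := by
  have h : ∀ X : Σ j : Fin n, SchemeTerm (Gamma A) k (k j) × Option (Fin (k j)), ∃ b, ∀ u y,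
      (∀ v, Derives rhs X.2.1 X.2.2 v → Derives rhs (rhs j) o (u ++ v ++ y)) →
        ∀ v, Derives rhs X.2.1 X.2.2 v → f v = b := by
    intro X
    by_cases hX : ∃ v, Derives rhs X.2.1 X.2.2 v
    · obtain ⟨v, hv⟩ := hX
      exact ⟨f v, fun u y h v' hv' => hf u v' v y (h v' hv') (h v hv)⟩
    -- A node that derives no word gets an arbitrary value.
    · exact ⟨0, fun u y _ v hv => absurd ⟨v, hv⟩ hX⟩
  choose b hb using h
  -- The bound depends only on the nodes and is fixed before `B`; this lets `B` exceed it later.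
  obtain ⟨M, hM⟩ := ((finite_nodes rhs).image b).bddAbove
  refine ⟨M, fun B hB w hw hl => ?_⟩
  obtain ⟨X, hX, u, v, y, h, h1, h2, hv, h3⟩ := hw.hasNodeFactor hB rfl (self_mem_subterms _) hl
  exact ⟨u, v, y, h, h1, h2, (hb X u y h3 v hv).trans_le (hM (Set.mem_image_of_mem b hX))⟩

end SchemeTerm

/-! ## The path language of the bag -/

namespace LTS

variable {A : Type}

/-- A vertex of the unfolding is itself a path of the system, and each edge of the unfolding appends
its own label to it. -/
theorem map_fst_of_isPath_unfolding [Countable A] (G : LTS A)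
    {p : List (Option A × G.unfolding.V)} {u : G.unfolding.V}
    (h : IsPath G.unfolding.Edge G.unfolding.root p u) :
    u.1.map Prod.fst = p.map Prod.fst := by
  induction p using List.reverseRecOn generalizing u with
  | nil => cases h; rfl
  | append_singleton p y ih =>
    obtain ⟨-, v, hv, s, hs⟩ := h.of_append_singleton
    rw [hs, List.map_append, ih hv, List.map_append]
    rfl

theorem mem_pathLanguage_unfolding [Countable A] (G : LTS A) {w : List A} :
    w ∈ G.unfolding.pathLanguage ↔
      ∃ p s, IsPath G.GraphEdge (some G.start) p (some s) ∧ p.map Prod.fst = w.map some ∧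
        G.Final s := by
  constructor
  · rintro ⟨p, u, v, hp, hw, z, hz⟩
    obtain ⟨s, hs⟩ := v.2
    rw [hz] at hs
    obtain ⟨-, x, hx, e⟩ := hs.of_append_singleton
    cases e with
    | exit hf => exact ⟨u.1, _, hx, (G.map_fst_of_isPath_unfolding hp).trans hw, hf⟩
  · rintro ⟨p, s, hp, hw, hs⟩
    obtain ⟨q, hq⟩ := G.unfolding.reach ⟨p, _, hp⟩
    exact ⟨q, _, ⟨p ++ [(none, none)], _, hp.append_singleton (.exit hs)⟩, hq,
      (G.map_fst_of_isPath_unfolding hq).symm.trans hw, none, rfl⟩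

/-! ### Counting letters in words of the bag -/

section Bag

variable {a b c d : A}

theorem count_of_isPath_bag [DecidableEq A] (hab : a ≠ b) (hac : a ≠ c) (had : a ≠ d)
    (hbc : b ≠ c) (hbd : b ≠ d) (hcd : c ≠ d) {s s' : ℕ × ℕ} {w : List A}
    {p : List (Option A × Option (ℕ × ℕ))}
    (h : IsPath (bag a b c d).GraphEdge (some s) p (some s')) (hw : p.map Prod.fst = w.map some) :
    s.1 + w.count a = s'.1 + w.count b ∧ s.2 + w.count c = s'.2 + w.count d := by
  induction w generalizing s p with
  | nil =>
    obtain rfl : p = [] := by simpa using hw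
    cases h
    simp
  | cons x w ih =>
    cases h with
    | nil => cases hw
    | cons e h =>
      cases e with
      | exit _ => exact absurd (List.cons.inj hw).1 nofun
      | step e =>
        obtain ⟨hx, hw'⟩ := List.cons.inj hw
        obtain rfl := Option.some.inj hx
        have := ih h hw'
        cases e <;> simp [hab, hac, had, hbc, hbd, hcd, hab.symm, hac.symm, had.symm, hbc.symm,
          hbd.symm, hcd.symm] at this ⊢ <;> omega

theorem exists_isPath_bag_replicate {x : A} {f : ℕ → ℕ × ℕ} {w : List A} {s : ℕ × ℕ} :
    ∀ n, (∀ i < n, BagStep a b c d (f i) x (f (i + 1))) →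
    (∃ p, IsPath (bag a b c d).GraphEdge (some (f n)) p (some s) ∧ p.map Prod.fst = w.map some) →
    ∃ p, IsPath (bag a b c d).GraphEdge (some (f 0)) p (some s) ∧
      p.map Prod.fst = (List.replicate n x ++ w).map some
  | 0, _, h => h
  | n + 1, hf, ⟨p, h, hw⟩ => by
    -- The last of the `n + 1` steps is moved into the remaining word, so the block is built from
    -- its end.
    have := exists_isPath_bag_replicate (w := x :: w) (s := s) n (fun i hi => hf i (by omega))
      ⟨_, .cons (.step (hf n (by omega))) h, by simp [hw]⟩
    rw [List.replicate_succ', List.append_assoc]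
    exact this

/-- A word in which the two kinds of items are put in and taken out crosswise. -/
def crossWord (a b c d : A) (n : ℕ) : List A :=
  List.replicate n a ++ (List.replicate n c ++ (List.replicate n b ++ (List.replicate n d ++ [])))

theorem crossWord_mem_pathLanguage [Countable A] (n : ℕ) :
    crossWord a b c d n ∈ (bagTree a b c d).pathLanguage := by
  have h : ∃ p, IsPath (bag a b c d).GraphEdge (some (0, 0)) p (some (0, 0)) ∧
      p.map Prod.fst = (crossWord a b c d n).map some := by
    -- The run goes around a square: `(0, 0)`, `(n, 0)`, `(n, n)`, `(0, n)`, `(0, 0)`.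
    refine exists_isPath_bag_replicate (f := fun i => (i, 0)) n (fun i _ => .a _ _) ?_
    refine exists_isPath_bag_replicate (f := fun i => (n, i)) n (fun i _ => .c _ _) ?_
    have h4 : ∃ p, IsPath (bag a b c d).GraphEdge (some (0, n)) p (some (0, 0)) ∧
        p.map Prod.fst = (List.replicate n d ++ []).map some := by
      have := exists_isPath_bag_replicate (a := a) (b := b) (c := c) (d := d) (x := d) (w := [])
        (s := (0, 0)) (f := fun i => (0, n - i)) n (fun i hi => ?_) ?_
      · simpa using this
      · have := BagStep.d (a := a) (b := b) (c := c) (d := d) 0 (n - (i + 1))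
        rwa [show n - (i + 1) + 1 = n - i by omega] at this
      · exact ⟨[], by simpa using IsPath.nil _, rfl⟩
    have := exists_isPath_bag_replicate (a := a) (b := b) (c := c) (d := d) (x := b)
      (w := List.replicate n d ++ []) (s := (0, 0)) (f := fun i => (n - i, n)) n (fun i hi => ?_) (by simpa using h4)
    · simpa using this
    · have := BagStep.b (a := a) (b := b) (c := c) (d := d) (n - (i + 1)) n
      rwa [show n - (i + 1) + 1 = n - i by omega] at this
  obtain ⟨p, hp, hw⟩ := h
  exact (mem_pathLanguage_unfolding _).2 ⟨p, _, hp, hw, rfl⟩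

theorem length_eq_count_of_forall_mem [DecidableEq A] (hab : a ≠ b) (hac : a ≠ c) (had : a ≠ d)
    (hbc : b ≠ c) (hbd : b ≠ d) (hcd : c ≠ d) {v : List A}
    (h : ∀ x ∈ v, x = a ∨ x = b ∨ x = c ∨ x = d) :
    v.length = v.count a + v.count b + v.count c + v.count d := by
  induction v with
  | nil => simp
  | cons x v ih =>
    have := ih fun y hy => h y (List.mem_cons_of_mem _ hy)
    rcases h x List.mem_cons_self with rfl | rfl | rfl | rfl <;>
      simp [*, hab.symm, hac.symm, had.symm, hbc.symm, hbd.symm, hcd.symm] <;>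
      omega

/-- A factor of the concatenation of three words that is no longer than the middle one does not
meet both of the outer ones. -/
theorem forall_mem_or_of_length_le {x y z u v w : List A} (h : x ++ y ++ z = u ++ v ++ w)
    (hv : v.length ≤ y.length) : (∀ e ∈ v, e ∈ x ++ y) ∨ ∀ e ∈ v, e ∈ y ++ z := by
  rcases le_total x.length u.length with hu | hu
  · right
    intro e he
    have h1 : e ∈ (x ++ y ++ z).drop u.length := by simp [h, he]
    rw [← Nat.add_sub_cancel' hu, ← List.drop_drop, List.append_assoc, List.drop_left] at h1
    exact List.mem_of_mem_drop h1
  · left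
    intro e he
    have h1 : e ∈ (x ++ y ++ z).take (u ++ v).length := by rw [h, List.take_left]; simp [he]
    have h2 : (u ++ v).length ≤ (x ++ y).length := by simp only [List.length_append]; omega
    rw [List.take_append_of_le_length h2] at h1
    exact List.mem_of_mem_take h1

/-- The absolute difference of the numbers of items of each kind put in and taken out, summed. -/
def imbalance [DecidableEq A] (a b c d : A) (v : List A) : ℕ :=
  ((v.count a : ℤ) - v.count b).natAbs + ((v.count c : ℤ) - v.count d).natAbs

/-- The `n` letters `c` separate the `a` from the `b`, and the `n` letters `b` separate the `c` from
the `d`. In a factor of length at most `n` each difference therefore has a zero term, so nothing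
cancels. -/
theorem imbalance_eq_length [DecidableEq A] (hab : a ≠ b) (hac : a ≠ c) (had : a ≠ d)
    (hbc : b ≠ c) (hbd : b ≠ d) (hcd : c ≠ d) {n : ℕ} {u v y : List A}
    (h : crossWord a b c d n = u ++ v ++ y) (hv : v.length ≤ n) :
    imbalance a b c d v = v.length := by
  have hl := length_eq_count_of_forall_mem hab hac had hbc hbd hcd (v := v) (fun x hx => by
    have : x ∈ crossWord a b c d n := by rw [h]; simp [hx]
    simp only [crossWord, List.mem_append, List.mem_replicate, List.not_mem_nil] at this
    tauto)
  have h1 : v.count a = 0 ∨ v.count b = 0 := by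
    rcases forall_mem_or_of_length_le (x := List.replicate n a) (y := List.replicate n c)
      (z := List.replicate n b ++ List.replicate n d) (by simpa [crossWord] using h)
      (by simpa using hv) with h | h
    · right
      exact List.count_eq_zero.2 fun hb => by simpa [hab.symm, hbc] using h b hb
    · left
      exact List.count_eq_zero.2 fun ha => by simpa [hab, hac, had] using h a ha
  have h2 : v.count c = 0 ∨ v.count d = 0 := by
    rcases forall_mem_or_of_length_le (x := List.replicate n a ++ List.replicate n c)
      (y := List.replicate n b) (z := List.replicate n d) (by simpa [crossWord] using h)
      (by simpa using hv) with h | h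
    · right
      exact List.count_eq_zero.2 fun hd => by
        simpa [had.symm, hbd.symm, hcd.symm] using h d hd
    · left
      exact List.count_eq_zero.2 fun hc => by simpa [hbc.symm, hcd] using h c hc
  unfold imbalance
  omega

end Bag

end LTS

/-! ### The contradiction -/

theorem not_languageEquivalent_bagTree {A : Type} [Countable A] {a b c d : A}
    (hab : a ≠ b) (hac : a ≠ c) (had : a ≠ d) (hbc : b ≠ c) (hbd : b ≠ d) (hcd : c ≠ d)
    {t : SyncTree A} (ht : t.IsGammaAlgebraic) : ¬ t.LanguageEquivalent (bagTree a b c d) := by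
  classical
  intro heq
  obtain ⟨E, h0, ⟨f⟩⟩ := ht
  have hL : ∀ w, w ∈ (bagTree a b c d).pathLanguage ↔
      SchemeTerm.Derives E.rhs (E.rhs 0) none w := fun w => by
    rw [← E.mem_pathLanguage_solution h0 _, ← SyncTree.pathLanguage_eq_of_iso f, heq]
  have hcount : ∀ w, SchemeTerm.Derives E.rhs (E.rhs 0) none w →
      w.count a = w.count b ∧ w.count c = w.count d := fun w hw => by
    obtain ⟨p, s, hp, hw, hs⟩ := (LTS.mem_pathLanguage_unfolding _).1 ((hL w).2 hw)
    have := LTS.count_of_isPath_bag hab hac had hbc hbd hcd hp hw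
    rw [show s = (0, 0) from hs] at this
    simpa [LTS.bag] using this
  -- Both words are balanced, so the counts in the common context `u`, `y` cancel and the signed
  -- differences for `v` and `v'` agree.
  obtain ⟨M, hM⟩ := SchemeTerm.exists_bounded_factor E.rhs 0 none (LTS.imbalance a b c d) (by
    intro u v v' y h h'
    have h1 := hcount _ h
    have h2 := hcount _ h'
    simp only [List.count_append] at h1 h2
    unfold LTS.imbalance
    omega)
  -- With `B = M + 1` the factor has length above `M + 1`; the block length `2 * B` is exactly its
  -- upper bound, as `imbalance_eq_length` requires.
  obtain ⟨u, v, y, h, h1, h2, h3⟩ := hM (M + 1) (by omega) _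
    ((hL _).1 (LTS.crossWord_mem_pathLanguage (2 * (M + 1))))
    (by simp [LTS.crossWord]; omega)
  rw [LTS.imbalance_eq_length hab hac had hbc hbd hcd h h2] at h3
  omega

theorem mainTheorem4 {A : Type} [Countable A] (a b c d : A)
    (hab : a ≠ b) (hac : a ≠ c) (had : a ≠ d) (hbc : b ≠ c) (hbd : b ≠ d) (hcd : c ≠ d) :
    ¬ SyncTree.IsGammaAlgebraic (bagTree a b c d) ∧
      ¬ ∃ t : SyncTree A, SyncTree.IsGammaAlgebraic t ∧
        SyncTree.LanguageEquivalent t (bagTree a b c d) :=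
  ⟨fun h => not_languageEquivalent_bagTree hab hac had hbc hbd hcd h rfl,
    fun ⟨_, ht, h⟩ => not_languageEquivalent_bagTree hab hac had hbc hbd hcd ht h⟩
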